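/- Let $K$ be a field, $\otimes=\otimes_K$; modules are left modules. For $f:\mathbb N\to\mathbb N\cup\{\infty\}$ put $\gamma(f):=\inf\{r\in\mathbb R_{\ge 0}\mid f(i)\le i^r \text{ for all } i\gg 0\}\in[0,\infty]$. For a finitely generated algebra $A=K\langle a_1,\dots,a_s\rangle$ let $A_1:=K+\sum_i Ka_i$ and $A_i:=A_1^i$ ($A_0=K$) be a standard filtration. Put $\mathrm{GK}(A):=\gamma(i\mapsto\dim_K A_i)$ and, for a finitely generated $A$-module $M=AM_0$ with $\dim_K M_0<\infty$, $\mathrm{GK}(M):=\gamma(i\mapsto\dim_K A_iM_0)$; for an arbitrary $A$-module, $\mathrm{GK}$ is the supremum of the values on its finitely generated submodules. For $A$ simple put $$\nu(i):=\min\{j\in\mathbb N\cup\{\infty\}\mid 1\in A_jaA_j\ \text{for all}\ 0\ne a\in A_i\},\qquad \lambda(i):=\min\{j\in\mathbb N\cup\{\infty\}\mid 1\in AaA_j\ \text{for all}\ 0\ne a\in A_i\},$$ where $A_jaA_j$ is the $K$-span of the elements $xay$ ($x,y\in A_j$), $AaA_j$ is the left ideal generated by $aA_j$, and the minimum is $\infty$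 if no natural number $j$ has the property. The filter dimension is $\mathrm{fd}(A):=\gamma(\nu)$ and the left filter dimension is $\mathrm{lfd}(A):=\gamma(\lambda)$. None of these numbers depends on the choice of the generators. The algebra $A$ is (left) finitely partitive if for every finitely generated $A$-module $M$ there is an integer $n>0$ such that $m\le n$ for every strictly descending chain of submodules $M=M_0\supset M_1\supset\dots\supset M_m$ with $\mathrm{GK}(M_i/M_{i+1})=\mathrm{GK}(M)$ for $0\le i<m$. Write $Q_0:=K$ and $Q_m:=K(x_1,\dots,x_m)$ for the field of rational functions in $m$ indeterminates. **Theorem.** Let $A$ be a simple finitely generated $K$-algebra with $0<n:=\mathrm{GK}(A)<\infty$. Suppose that for every $m\ge 0$ the $Q_m$-algebra $Q_m\otimes A$ is simple and finitely partitive, and that the Gelfand–Kirillov dimension over $Q_m$ of every finitely generated $Q_m\otimes A$-module is a natural number. Let $S$ be a left Ore subset (left denominator set) of $A$, let $S^{-1}A$ be the localization of $A$ at $S$, and let $L$ be a (commutative) subfield of $S^{-1}A$ that contains $K$. Let $d$ be either $\mathrm{fd}$ or $\mathrm{lfd}$, and let $$f_A:=\max\{d_{Q_m}(Q_m\otimes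 A)\mid 0\le m\le n\}\in[0,\infty],$$ where $d_{Q_m}$ is computed over the field $Q_m$. Then $$\mathrm{tr.deg}_K(L)\le \mathrm{GK}(A)\left(1-\frac{1}{f_A+\max\{f_A,1\}}\right),$$ with $1/\infty:=0$. -/

import Mathlib

open Filter TensorProduct OreLocalization
open scoped ENNReal NNReal

universe u v

noncomputable section

/-- The degree `γ(f) = inf {r | f(i) ≤ i ^ r for i ≫ 0}` of a function `f : ℕ → ℕ ∪ {∞}`, an
element of `[0, ∞]`. The infimum is over real numbers `r ≥ 0`, and the infimum of the empty set
is `∞`. -/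
def growthDegree (f : ℕ → ℕ∞) : ℝ≥0∞ :=
  ⨅ (r : ℝ≥0) (_ : ∀ᶠ i : ℕ in atTop, ((f i : ℕ∞) : ℝ≥0∞) ≤ (i : ℝ≥0∞) ^ (r : ℝ)), (r : ℝ≥0∞)

section Algebras

variable (K : Type*) [Field K] (A : Type*) [Ring A] [Algebra K A]

/-- `V` is the first term `A₁ = K + K a₁ + ⋯ + K aₛ` of a standard filtration
`A₀ = K ⊆ A₁ ⊆ ⋯ ⊆ Aᵢ = A₁ ^ i ⊆ ⋯` of the `K`-algebra `A`: a finite dimensional subspace of `A`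
that contains `1` and generates `A` as an algebra. -/
structure IsStandardGenerating (V : Submodule K A) : Prop where
  finiteDimensional : FiniteDimensional K V
  one_mem : (1 : A) ∈ V
  adjoin_eq_top : Algebra.adjoin K (V : Set A) = ⊤

/-- The Gelfand-Kirillov dimension over `K` of a finitely generated `K`-algebra `A`:
the degree of `i ↦ dim_K Aᵢ`, where `Aᵢ = V ^ i` is a standard filtration of `A`. All standard
filtrations give the same value, and the supremum is this value. -/
def gkDimAlgebra : ℝ≥0∞ :=
  ⨆ (V : Submodule K A) (_ : IsStandardGenerating K A V),
    growthDegree fun i => (Module.finrank K ↥(V ^ i) : ℕ∞)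

/-- The subspace `W M₀` of an `A`-module spanned by the products `a • m`, `a ∈ W`, `m ∈ M₀`. -/
def smulSpan {K : Type*} [Field K] {A : Type*} [Ring A] [Algebra K A]
    {M : Type*} [AddCommGroup M] [Module K M] [Module A M]
    (W : Submodule K A) (M₀ : Submodule K M) : Submodule K M :=
  Submodule.span K {x : M | ∃ a ∈ W, ∃ m ∈ M₀, x = a • m}

/-- The Gelfand-Kirillov dimension over `K` of a (left) module `M` over a finitely generated
`K`-algebra `A`: the supremum of the degrees of `i ↦ dim_K (Aᵢ M₀)` over the finite dimensional
subspaces `M₀` of `M`, where `Aᵢ = V ^ i` is a standard filtration of `A`. If `M` is finitely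
generated, the supremum is attained at every `M₀` that generates `M`; in general it is the supremum
of the Gelfand-Kirillov dimensions of the finitely generated submodules of `M`. -/
def gkDimModule (M : Type*) [AddCommGroup M] [Module K M] [Module A M]
    [IsScalarTower K A M] : ℝ≥0∞ :=
  ⨆ (V : Submodule K A) (_ : IsStandardGenerating K A V)
    (M₀ : Submodule K M) (_ : FiniteDimensional K M₀),
    growthDegree fun i => (Module.finrank K ↥(smulSpan (V ^ i) M₀) : ℕ∞)

/-- The return function `ν_F` of `A` for the standard filtration `Aᵢ = V ^ i`: `ν_F(i)` is the least
`j ∈ ℕ ∪ {∞}` with `1 ∈ Aⱼ a Aⱼ` for all `0 ≠ a ∈ Aᵢ`. -/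
def returnFunction {K : Type*} [Field K] {A : Type*} [Ring A] [Algebra K A]
    (V : Submodule K A) (i : ℕ) : ℕ∞ :=
  ⨅ (j : ℕ) (_ : ∀ a ∈ V ^ i, a ≠ 0 → (1 : A) ∈ V ^ j * Submodule.span K {a} * V ^ j), (j : ℕ∞)

/-- The left return function `λ_F` of `A` for the standard filtration `Aᵢ = V ^ i`: `λ_F(i)` is the
least `j ∈ ℕ ∪ {∞}` with `1 ∈ A a Aⱼ` for all `0 ≠ a ∈ Aᵢ`, where `A a Aⱼ` is the left ideal
generated by `a Aⱼ`. -/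
def leftReturnFunction {K : Type*} [Field K] {A : Type*} [Ring A] [Algebra K A]
    (V : Submodule K A) (i : ℕ) : ℕ∞ :=
  ⨅ (j : ℕ) (_ : ∀ a ∈ V ^ i, a ≠ 0 → (1 : A) ∈ Ideal.span {x : A | ∃ y ∈ V ^ j, x = a * y}),
    (j : ℕ∞)

/-- The filter dimension `fd(A) = γ(ν_F)` of a simple finitely generated `K`-algebra `A`.
All standard filtrations `F` give the same value, and the supremum is this value. -/
def filterDim : ℝ≥0∞ :=
  ⨆ (V : Submodule K A) (_ : IsStandardGenerating K A V), growthDegree (returnFunction V)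

/-- The left filter dimension `lfd(A) = γ(λ_F)` of a simple finitely generated `K`-algebra `A`.
All standard filtrations `F` give the same value, and the supremum is this value. -/
def leftFilterDim : ℝ≥0∞ :=
  ⨆ (V : Submodule K A) (_ : IsStandardGenerating K A V), growthDegree (leftReturnFunction V)

end Algebras

/-- The `K`-algebra `A` is (left) finitely partitive: for every finitely generated (left)
`A`-module `M` there is an integer `n > 0` such that `m ≤ n` for every strictly descending chain
`M = N 0 ⊃ N 1 ⊃ ⋯ ⊃ N m` of `A`-submodules with `GK(N i / N (i + 1)) = GK(M)` for all `i < m`.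
Every finitely generated `A`-module is isomorphic to one in the universe of `A`. -/
def IsFinitelyPartitive (K : Type u) [Field K] (A : Type v) [Ring A] [Algebra K A] : Prop :=
  ∀ (M : Type v) [AddCommGroup M] [Module K M] [Module A M] [IsScalarTower K A M],
    Module.Finite A M →
    ∃ n : ℕ, 0 < n ∧ ∀ (m : ℕ) (N : Fin (m + 1) → Submodule A M),
      N 0 = ⊤ → StrictAnti N →
      (∀ i : Fin m,
        gkDimModule K A (↥(N i.castSucc) ⧸ (N i.succ).submoduleOf (N i.castSucc)) =
          gkDimModule K A M) →
      m ≤ n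

/-- The Gelfand-Kirillov dimension over `K` of every finitely generated (left) `A`-module is a
natural number. -/
def HasNatGKDims (K : Type u) [Field K] (A : Type v) [Ring A] [Algebra K A] : Prop :=
  ∀ (M : Type v) [AddCommGroup M] [Module K M] [Module A M] [IsScalarTower K A M],
    Module.Finite A M → ∃ k : ℕ, gkDimModule K A M = (k : ℝ≥0∞)

/-- The field `Q_m = K(x_1, …, x_m)` of rational functions in `m` indeterminates. -/
abbrev RatFuncField (K : Type u) [Field K] (m : ℕ) : Type u :=
  FractionRing (MvPolynomial (Fin m) K)

/-- The number `f_A = max {fd_{Q_m}(Q_m ⊗ A) | 0 ≤ m ≤ GK(A)}` for the filter dimension. -/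
def maxFilterDim (K : Type u) [Field K] (A : Type v) [Ring A] [Algebra K A] : ℝ≥0∞ :=
  ⨆ (m : ℕ) (_ : (m : ℝ≥0∞) ≤ gkDimAlgebra K A),
    filterDim (RatFuncField K m) (RatFuncField K m ⊗[K] A)

/-- The number `f_A = max {lfd_{Q_m}(Q_m ⊗ A) | 0 ≤ m ≤ GK(A)}` for the left filter dimension. -/
def maxLeftFilterDim (K : Type u) [Field K] (A : Type v) [Ring A] [Algebra K A] : ℝ≥0∞ :=
  ⨆ (m : ℕ) (_ : (m : ℝ≥0∞) ≤ gkDimAlgebra K A),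
    leftFilterDim (RatFuncField K m) (RatFuncField K m ⊗[K] A)

/-- The transcendence degree over `K`, in `ℕ ∪ {∞}`, of a `K`-subalgebra `L` that is a field. -/
def subfieldTrdeg {K : Type*} [Field K] {B : Type*} [Ring B] [Algebra K B]
    (L : Subalgebra K B) (hL : IsField L) : ℕ∞ :=
  letI : Field L := hL.toField
  letI : Algebra K L := L.algebra
  Cardinal.toENat (Algebra.trdeg K L)

end

/-! It suffices to treat `lfd`, since `lfd ≤ fd` and the bound increases with `f_A`. Let `x₁, …, xₘ`
in `L` be algebraically independent and let `f` be the left filter dimension of `Q_m ⊗ A`. The core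
is the inequality `GK(A) / (f + max f 1) + m ≤ GK(A)`: it forces `m ≤ GK(A)`, hence `f ≤ f_A`, and
the bound follows by subtraction.

The inequality comes from a module. On `T = (S⁻¹A)[[t₁, …, tₘ]]`, with central variables, let `A`
act by left multiplication and `q ∈ Q_m` by right multiplication with its Taylor expansion `q(x +
t)`. The submodule generated by `1` is an image of `Q_m ⊗ A`, so its dimension is at most `GK(A)`.
The lower bound goes through `T_j = T / (t₁, …, t_j)`, with `j` descending from `m` to `0`: each
submodule of `T_j` generated by some `s ∈ S` has dimension at least `GK(A) / (f + max f 1) + (m -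
j)`.

For `j = m` this is the filter inequality `growthDegree_finrank_pow_div_le`, valid for every nonzero
module. Each descent gains `1`. Multiplication by `t_{j+1}` is injective on `T_j` with cokernel
`T_{j+1}`. The intersections of the cyclic module with the images of its powers descend strictly
forever, and each factor has a subquotient that is a cyclic submodule of `T_{j+1}` generated by an
element of `S` (`exists_quotCyclic_le`). Finite partitivity yields a factor of smaller dimension,
and integrality makes the gap at least `1` (`IsFinitelyPartitive.add_one_le_gkDimModule`). -/

/-! ### Degrees of growth. -/

theorem growthDegree_mono {f g : ℕ → ℕ∞} (h : ∀ᶠ i in atTop, f i ≤ g i) :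
    growthDegree f ≤ growthDegree g := by
  refine le_iInf₂ fun r hr => iInf₂_le r ?_
  filter_upwards [h, hr] with i hi hri
  exact (ENat.toENNReal_le.2 hi).trans hri

theorem eventually_le_of_growthDegree_lt {f : ℕ → ℕ∞} {r : ℝ≥0} (h : growthDegree f < r) :
    ∀ᶠ i : ℕ in atTop, ((f i : ℕ∞) : ℝ≥0∞) ≤ (i : ℝ≥0∞) ^ (r : ℝ) := by
  simp only [growthDegree, iInf_lt_iff] at h
  obtain ⟨s, hs, hsr⟩ := h
  filter_upwards [hs, eventually_ge_atTop 1] with i hi h1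
  refine hi.trans (ENNReal.rpow_le_rpow_of_exponent_le (by exact_mod_cast h1) ?_)
  exact_mod_cast hsr.le

theorem eventually_const_le_rpow (C : ℝ≥0) {ε : ℝ≥0} (hε : 0 < ε) :
    ∀ᶠ i : ℕ in atTop, (C : ℝ≥0∞) ≤ (i : ℝ≥0∞) ^ (ε : ℝ) := by
  have h := ((tendsto_rpow_atTop (y := (ε : ℝ)) (by exact_mod_cast hε)).comp
    tendsto_natCast_atTop_atTop).eventually_ge_atTop (C : ℝ)
  filter_upwards [h] with i hi
  have : C ≤ (i : ℝ≥0) ^ (ε : ℝ) := by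
    rw [← NNReal.coe_le_coe]
    simpa using hi
  calc (C : ℝ≥0∞) ≤ (((i : ℝ≥0) ^ (ε : ℝ) : ℝ≥0) : ℝ≥0∞) := by exact_mod_cast this
    _ = _ := by rw [ENNReal.coe_rpow_of_nonneg _ (by positivity)]; simp

theorem growthDegree_le_of_eventually_le_const_mul {f : ℕ → ℕ∞} (C r : ℝ≥0)
    (h : ∀ᶠ i : ℕ in atTop, ((f i : ℕ∞) : ℝ≥0∞) ≤ C * (i : ℝ≥0∞) ^ (r : ℝ)) :
    growthDegree f ≤ r := by
  refine ENNReal.le_of_forall_pos_le_add fun ε hε _ => ?_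
  rw [← ENNReal.coe_add]
  refine iInf₂_le (r + ε) ?_
  filter_upwards [h, eventually_const_le_rpow C hε, eventually_ge_atTop 1] with i hi hC h1
  have h0 : (i : ℝ≥0∞) ≠ 0 := by exact_mod_cast (by omega : i ≠ 0)
  rw [NNReal.coe_add, add_comm, ENNReal.rpow_add _ _ h0 (ENNReal.natCast_ne_top i)]
  exact hi.trans (by gcongr)

/-- Absorbs a change of filtration: `c * i + d ≤ (c + d) * i`, and a constant factor does not affect
the degree. -/
theorem growthDegree_comp_affine_le (g : ℕ → ℕ∞) {c : ℕ} (hc : 0 < c) (d : ℕ) :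
    growthDegree (fun i => g (c * i + d)) ≤ growthDegree g := by
  refine le_iInf₂ fun r hr => ?_
  refine growthDegree_le_of_eventually_le_const_mul (((c + d : ℕ) : ℝ≥0) ^ (r : ℝ)) r ?_
  have ht : Tendsto (fun i => c * i + d) atTop atTop := by
    refine tendsto_atTop_mono (fun i => ?_) tendsto_id
    simp only [id]
    nlinarith
  filter_upwards [ht.eventually hr, eventually_ge_atTop 1] with i hi h1
  refine hi.trans ?_
  rw [ENNReal.coe_rpow_of_nonneg _ r.coe_nonneg,
    ← ENNReal.mul_rpow_of_nonneg _ _ r.coe_nonneg]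
  refine ENNReal.rpow_le_rpow ?_ r.coe_nonneg
  have : c * i + d ≤ (c + d) * i := by nlinarith
  exact_mod_cast this

/-- Take `j = ⌊i ^ r⌋`, which is at least `l i` for large `i` and tends to infinity because `r > 0`.
Then `D j ≤ i ^ (r * s)` and `D (i + j) ≤ (2 * i ^ max r 1) ^ s`. -/
theorem growthDegree_le_mul_of_le_mul {g D : ℕ → ℕ} {l : ℕ → ℕ∞}
    (h : ∀ i j : ℕ, l i ≤ j → g i ≤ D j * D (i + j)) {s r : ℝ≥0}
    (hs : growthDegree (fun i => (D i : ℕ∞)) < s) (hr : growthDegree l < r) :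
    growthDegree (fun i => (g i : ℕ∞)) ≤ ((s * (r + max r 1) : ℝ≥0) : ℝ≥0∞) := by
  have hr0 : 0 < r := by exact_mod_cast (zero_le.trans_lt hr)
  refine growthDegree_le_of_eventually_le_const_mul ((2 : ℝ≥0) ^ (s : ℝ)) _ ?_
  have hD := eventually_le_of_growthDegree_lt hs
  have hl := eventually_le_of_growthDegree_lt hr
  have ht : Tendsto (fun i : ℕ => ⌊(i : ℝ≥0) ^ (r : ℝ)⌋₊) atTop atTop :=
    tendsto_nat_floor_atTop.comp
      (((NNReal.tendsto_rpow_atTop (by exact_mod_cast hr0))).comp tendsto_natCast_atTop_atTop)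
  have hD2 : ∀ᶠ i : ℕ in atTop, ((D (i + ⌊(i : ℝ≥0) ^ (r : ℝ)⌋₊) : ℕ∞) : ℝ≥0∞) ≤
      ((i + ⌊(i : ℝ≥0) ^ (r : ℝ)⌋₊ : ℕ) : ℝ≥0∞) ^ (s : ℝ) :=
    (tendsto_atTop_mono (fun i => Nat.le_add_right i _) tendsto_id).eventually hD
  filter_upwards [ht.eventually hD, hD2, hl, eventually_ge_atTop 1] with i h1 h2 h3 hi
  set j := ⌊(i : ℝ≥0) ^ (r : ℝ)⌋₊ with hj
  have hjr : (j : ℝ≥0∞) ≤ (i : ℝ≥0∞) ^ (r : ℝ) := by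
    have : (j : ℝ≥0) ≤ (i : ℝ≥0) ^ (r : ℝ) := Nat.floor_le (by positivity)
    calc (j : ℝ≥0∞) = ((j : ℝ≥0) : ℝ≥0∞) := by simp
      _ ≤ (((i : ℝ≥0) ^ (r : ℝ) : ℝ≥0) : ℝ≥0∞) := by exact_mod_cast this
      _ = _ := by rw [ENNReal.coe_rpow_of_nonneg _ (by positivity)]; simp
  have hlj : l i ≤ j := by
    have hfin : l i ≠ ⊤ := by
      intro htop
      rw [htop] at h3
      simp at h3
    obtain ⟨k, hk⟩ := ENat.ne_top_iff_exists.1 hfin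
    rw [← hk] at h3 ⊢
    have : (k : ℝ≥0) ≤ (i : ℝ≥0) ^ (r : ℝ) := by
      rw [← ENNReal.coe_le_coe, ENNReal.coe_rpow_of_nonneg _ r.coe_nonneg]
      simpa using h3
    exact_mod_cast Nat.le_floor this
  have hi1 : (1 : ℝ≥0∞) ≤ i := by exact_mod_cast hi
  have hi0 : (i : ℝ≥0∞) ≠ 0 := (zero_lt_one.trans_le hi1).ne'
  have hit := ENNReal.natCast_ne_top i
  have hij : ((i + j : ℕ) : ℝ≥0∞) ≤ 2 * (i : ℝ≥0∞) ^ ((max r 1 : ℝ≥0) : ℝ) := by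
    push_cast
    rw [two_mul]
    refine add_le_add ?_ (hjr.trans (ENNReal.rpow_le_rpow_of_exponent_le hi1 (by simp)))
    calc (i : ℝ≥0∞) = (i : ℝ≥0∞) ^ (1 : ℝ) := by simp
      _ ≤ _ := ENNReal.rpow_le_rpow_of_exponent_le hi1 (by simp)
  calc (((g i : ℕ) : ℕ∞) : ℝ≥0∞) ≤ ((D j * D (i + j) : ℕ) : ℝ≥0∞) := by
        simpa using (by exact_mod_cast h i j hlj : ((g i : ℕ) : ℝ≥0∞) ≤ ((D j * D (i + j) : ℕ) : ℝ≥0∞))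
    _ ≤ (j : ℝ≥0∞) ^ (s : ℝ) * ((i + j : ℕ) : ℝ≥0∞) ^ (s : ℝ) := by
        rw [Nat.cast_mul]
        exact mul_le_mul' (by simpa using h1) (by simpa using h2)
    _ ≤ ((i : ℝ≥0∞) ^ (r : ℝ)) ^ (s : ℝ) *
          (2 * (i : ℝ≥0∞) ^ ((max r 1 : ℝ≥0) : ℝ)) ^ (s : ℝ) := by gcongr
    _ = ((2 ^ (s : ℝ) : ℝ≥0) : ℝ≥0∞) *
          (i : ℝ≥0∞) ^ ((s * (r + max r 1) : ℝ≥0) : ℝ) := by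
        rw [ENNReal.mul_rpow_of_nonneg _ _ s.coe_nonneg, ← ENNReal.rpow_mul, ← ENNReal.rpow_mul,
          ENNReal.coe_rpow_of_nonneg _ s.coe_nonneg, mul_left_comm, ← ENNReal.rpow_add _ _ hi0 hit]
        congr 2
        push_cast
        ring

/-- The previous bound needs exponents strictly above both degrees; the excess `ε` tends to `0`. -/
theorem growthDegree_le_of_le_mul {g D : ℕ → ℕ} {l : ℕ → ℕ∞}
    (h : ∀ i j : ℕ, l i ≤ j → g i ≤ D j * D (i + j))
    (hD : growthDegree (fun i => (D i : ℕ∞)) ≠ ⊤) (hl : growthDegree l ≠ ⊤) :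
    growthDegree (fun i => (g i : ℕ∞)) ≤
      growthDegree (fun i => (D i : ℕ∞)) * (growthDegree l + max (growthDegree l) 1) := by
  obtain ⟨a, ha⟩ : ∃ a : ℝ≥0, (a : ℝ≥0∞) = _ := ⟨_, ENNReal.coe_toNNReal hD⟩
  obtain ⟨b, hb⟩ : ∃ b : ℝ≥0, (b : ℝ≥0∞) = _ := ⟨_, ENNReal.coe_toNNReal hl⟩
  rw [← ha, ← hb]
  have hc : Continuous fun ε : ℝ≥0 =>
      (((a + ε) * ((b + ε) + max (b + ε) 1) : ℝ≥0) : ℝ≥0∞) :=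
    ENNReal.continuous_coe.comp (by fun_prop)
  have ht := (hc.tendsto 0).mono_left (nhdsWithin_le_nhds (s := Set.Ioi 0))
  have hlim : ((a * (b + max b 1) : ℝ≥0) : ℝ≥0∞) = (a : ℝ≥0∞) * (b + max (b : ℝ≥0∞) 1) := by
    push_cast
    rfl
  rw [← hlim]
  simp only [add_zero] at ht
  refine ge_of_tendsto ht ?_
  filter_upwards [self_mem_nhdsWithin] with ε hε
  have hε : 0 < ε := hε
  refine growthDegree_le_mul_of_le_mul h ?_ ?_
  · rw [← ha]
    exact_mod_cast lt_add_of_pos_right a hε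
  · rw [← hb]
    exact_mod_cast lt_add_of_pos_right b hε

/-! ### Gelfand-Kirillov dimension of modules and the filter inequality. -/

section GKModules

variable {K : Type*} [Field K] {A : Type*} [Ring A] [Algebra K A]
  {M : Type*} [AddCommGroup M] [Module K M] [Module A M]

theorem smul_mem_smulSpan {W : Submodule K A} {M₀ : Submodule K M} {a : A} {x : M}
    (ha : a ∈ W) (hx : x ∈ M₀) : a • x ∈ smulSpan W M₀ :=
  Submodule.subset_span ⟨a, ha, x, hx, rfl⟩

theorem smulSpan_le {W : Submodule K A} {M₀ P : Submodule K M}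
    (h : ∀ a ∈ W, ∀ x ∈ M₀, a • x ∈ P) : smulSpan W M₀ ≤ P := by
  refine Submodule.span_le.2 ?_
  rintro _ ⟨a, ha, x, hx, rfl⟩
  exact h a ha x hx

variable [IsScalarTower K A M]
  {N : Type*} [AddCommGroup N] [Module K N] [Module A N] [IsScalarTower K A N]

theorem smulSpan_eq_map₂ (W : Submodule K A) (M₀ : Submodule K M) :
    smulSpan W M₀ = Submodule.map₂ (Algebra.lsmul K K M : A →ₐ[K] Module.End K M).toLinearMap
      W M₀ := by
  rw [smulSpan, Submodule.map₂_eq_span_image2]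
  congr 1
  ext x
  simp [Set.mem_smul, eq_comm]

theorem finiteDimensional_smulSpan {W : Submodule K A} {M₀ : Submodule K M}
    (hW : FiniteDimensional K W) (hM : FiniteDimensional K M₀) :
    FiniteDimensional K (smulSpan W M₀) := by
  rw [smulSpan_eq_map₂]
  exact Module.Finite.iff_fg.2 ((Module.Finite.iff_fg.1 hW).map₂ _ (Module.Finite.iff_fg.1 hM))

theorem finiteDimensional_pow {V : Submodule K A} (hV : FiniteDimensional K V) (i : ℕ) :
    FiniteDimensional K (V ^ i : Submodule K A) :=
  Module.Finite.iff_fg.2 ((Module.Finite.iff_fg.1 hV).pow i)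

theorem smul_smulSpan_mem {U V : Submodule K A} {M₀ : Submodule K M} {a : A} {x : M}
    (ha : a ∈ U) (hx : x ∈ smulSpan V M₀) : a • x ∈ smulSpan (U * V) M₀ := by
  have h : smulSpan V M₀ ≤ (smulSpan (U * V) M₀).comap (Algebra.lsmul K K M a) := by
    refine smulSpan_le fun b hb y hy => ?_
    have := smul_mem_smulSpan (Submodule.mul_mem_mul ha hb) hy
    simpa [mul_smul] using this
  exact h hx

theorem map_smulSpan (f : M →ₗ[A] N) (W : Submodule K A) (M₀ : Submodule K M) :
    (smulSpan W M₀).map (f.restrictScalars K) = smulSpan W (M₀.map (f.restrictScalars K)) := by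
  apply le_antisymm
  · rw [Submodule.map_le_iff_le_comap]
    refine smulSpan_le fun a ha x hx => ?_
    simpa using smul_mem_smulSpan ha (Submodule.mem_map_of_mem (f := f.restrictScalars K) hx)
  · refine smulSpan_le ?_
    rintro a ha _ ⟨x, hx, rfl⟩
    exact ⟨a • x, smul_mem_smulSpan ha hx, by simp⟩

theorem gkDimModule_le_of_forall {P : Type*} [AddCommGroup P] [Module K P] [Module A P]
    [IsScalarTower K A P]
    (h : ∀ (V : Submodule K A), IsStandardGenerating K A V → ∀ M₀ : Submodule K M,
      FiniteDimensional K M₀ → ∃ P₀ : Submodule K P, FiniteDimensional K P₀ ∧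
        ∀ i, Module.finrank K (smulSpan (V ^ i) M₀) ≤ Module.finrank K (smulSpan (V ^ i) P₀)) :
    gkDimModule K A M ≤ gkDimModule K A P := by
  refine iSup₂_le fun V hV => iSup₂_le fun M₀ hM => ?_
  obtain ⟨P₀, hP, hle⟩ := h V hV M₀ hM
  refine le_trans (growthDegree_mono (Eventually.of_forall fun i => ?_))
    (le_iSup₂_of_le V hV (le_iSup₂_of_le P₀ hP le_rfl))
  exact_mod_cast hle i

theorem gkDimModule_le_of_injective (f : M →ₗ[A] N) (hf : Function.Injective f) :
    gkDimModule K A M ≤ gkDimModule K A N := by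
  refine gkDimModule_le_of_forall fun V hV M₀ hM =>
    ⟨M₀.map (f.restrictScalars K), inferInstance, fun i => ?_⟩
  rw [← map_smulSpan]
  exact (Submodule.equivMapOfInjective (f.restrictScalars K) hf _).finrank_eq.le

theorem gkDimModule_le_of_surjective (f : M →ₗ[A] N) (hf : Function.Surjective f) :
    gkDimModule K A N ≤ gkDimModule K A M := by
  refine gkDimModule_le_of_forall fun V hV N₀ hN => ?_
  obtain ⟨g, hg⟩ := (f.restrictScalars K).exists_rightInverse_of_surjective
    (LinearMap.range_eq_top.2 hf)
  obtain ⟨M₀, hM', rfl⟩ : ∃ M₀ : Submodule K M, FiniteDimensional K M₀ ∧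
      M₀.map (f.restrictScalars K) = N₀ :=
    ⟨N₀.map g, inferInstance, by rw [← Submodule.map_comp, hg, Submodule.map_id]⟩
  refine ⟨M₀, hM', fun i => ?_⟩
  have := finiteDimensional_smulSpan (finiteDimensional_pow hV.finiteDimensional i) hM'
  rw [← map_smulSpan]
  exact Submodule.finrank_map_le _ _

/-- `range g` is a quotient of `range f`, hence a subquotient of `M`. -/
theorem gkDimModule_range_le_of_ker_le {P : Type*} [AddCommGroup P] [Module A P]
    (f : P →ₗ[A] M) (g : P →ₗ[A] N) (h : LinearMap.ker f ≤ LinearMap.ker g) :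
    gkDimModule K A (LinearMap.range g) ≤ gkDimModule K A M := by
  let q : (P ⧸ LinearMap.ker f) →ₗ[A] LinearMap.range g :=
    (LinearMap.ker f).liftQ g.rangeRestrict (by rwa [LinearMap.ker_rangeRestrict])
  let p : LinearMap.range f →ₗ[A] LinearMap.range g :=
    q ∘ₗ f.quotKerEquivRange.symm.toLinearMap
  have hp : Function.Surjective p := by
    refine Function.Surjective.comp (g := q) ?_ f.quotKerEquivRange.symm.surjective
    rintro ⟨_, x, rfl⟩
    exact ⟨Submodule.Quotient.mk x, rfl⟩
  exact (gkDimModule_le_of_surjective p hp).trans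
    (gkDimModule_le_of_injective (LinearMap.range f).subtype Subtype.val_injective)

theorem one_mem_leftIdeal_of_leftReturnFunction_le {V : Submodule K A} (hV : (1 : A) ∈ V)
    {i j : ℕ} (h : leftReturnFunction V i ≤ j) {a : A} (ha : a ∈ V ^ i) (ha0 : a ≠ 0) :
    (1 : A) ∈ Ideal.span {x : A | ∃ y ∈ V ^ j, x = a * y} := by
  -- Comparing strictly with `j + 1` produces a natural number `k ≤ j` with the return property,
  -- which passes from `k` to `j` because `V ^ k ≤ V ^ j`.
  have h' : leftReturnFunction V i < ((j + 1 : ℕ) : ℕ∞) :=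
    h.trans_lt (by exact_mod_cast Nat.lt_succ_self j)
  simp only [leftReturnFunction, iInf_lt_iff] at h'
  obtain ⟨k, hk, hkj⟩ := h'
  have hkj : k ≤ j := Nat.lt_succ_iff.1 (by exact_mod_cast hkj)
  refine Ideal.span_mono ?_ (hk a ha ha0)
  rintro _ ⟨y, hy, rfl⟩
  exact ⟨y, pow_le_pow_right' (Submodule.one_le.2 hV) hkj hy, rfl⟩

/-- If `a ∈ V ^ i` is nonzero and kills `V ^ j M₀`, then `1 ∈ A a V ^ j` kills `M₀ ≠ 0`, a
contradiction. Hence `V ^ i` embeds into the linear maps from `V ^ j M₀` to `V ^ (i + j) M₀`. -/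
theorem finrank_pow_le_mul {V : Submodule K A} (hV : FiniteDimensional K V) (hV1 : (1 : A) ∈ V)
    {M₀ : Submodule K M} (hM : FiniteDimensional K M₀) (hM0 : M₀ ≠ ⊥) {i j : ℕ}
    (h : leftReturnFunction V i ≤ j) :
    Module.finrank K (V ^ i : Submodule K A) ≤
      Module.finrank K (smulSpan (V ^ j) M₀) * Module.finrank K (smulSpan (V ^ (i + j)) M₀) := by
  have h1 := finiteDimensional_smulSpan (finiteDimensional_pow hV j) hM
  have h2 := finiteDimensional_smulSpan (finiteDimensional_pow hV (i + j)) hM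
  have hmem (a : (V ^ i : Submodule K A)) (x : smulSpan (V ^ j) M₀) :
      (a : A) • (x : M) ∈ smulSpan (V ^ (i + j)) M₀ := by
    rw [pow_add]
    exact smul_smulSpan_mem a.2 x.2
  let φ : (V ^ i : Submodule K A) →ₗ[K]
      smulSpan (V ^ j) M₀ →ₗ[K] smulSpan (V ^ (i + j)) M₀ :=
    LinearMap.mk₂ K (fun a x => ⟨(a : A) • (x : M), hmem a x⟩)
      (fun a b x => Subtype.ext (by simp [add_smul]))
      (fun c a x => Subtype.ext (by simp))
      (fun a x y => Subtype.ext (by simp))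
      (fun c a x => Subtype.ext (by simp [smul_algebra_smul_comm]))
  have hφ : Function.Injective φ := by
    refine (injective_iff_map_eq_zero φ).2 fun a ha => ?_
    by_contra ha0
    have hone := one_mem_leftIdeal_of_leftReturnFunction_le hV1 h a.2
      (fun h0 => ha0 (Subtype.ext h0))
    obtain ⟨x, hx, hx0⟩ := Submodule.exists_mem_ne_zero_of_ne_bot hM0
    have hle : Ideal.span {z : A | ∃ y ∈ V ^ j, z = (a : A) * y} ≤
        LinearMap.ker (LinearMap.toSpanSingleton A M x) := by
      refine Ideal.span_le.2 ?_
      rintro _ ⟨y, hy, rfl⟩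
      have := congrArg Subtype.val (LinearMap.congr_fun ha ⟨y • x, smul_mem_smulSpan hy hx⟩)
      simpa [φ, mul_smul] using this
    have := hle hone
    simp at this
    exact hx0 this
  calc _ ≤ Module.finrank K (smulSpan (V ^ j) M₀ →ₗ[K] smulSpan (V ^ (i + j)) M₀) :=
        LinearMap.finrank_le_finrank_of_injective hφ
    _ = _ := Module.finrank_linearMap _ _ _ _

variable (M) in
/-- The filter inequality. -/
theorem growthDegree_finrank_pow_div_le [Nontrivial M] {V : Submodule K A}
    (hV : IsStandardGenerating K A V) :
    growthDegree (fun i => (Module.finrank K (V ^ i : Submodule K A) : ℕ∞)) /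
      (leftFilterDim K A + max (leftFilterDim K A) 1) ≤ gkDimModule K A M := by
  obtain ⟨x, hx⟩ := exists_ne (0 : M)
  have hl : growthDegree (leftReturnFunction V) ≤ leftFilterDim K A :=
    le_iSup₂_of_le V hV le_rfl
  have hD : growthDegree (fun i => (Module.finrank K (smulSpan (V ^ i) (K ∙ x)) : ℕ∞)) ≤
      gkDimModule K A M :=
    le_iSup₂_of_le V hV (le_iSup₂_of_le (K ∙ x) inferInstance le_rfl)
  rcases eq_or_ne (leftFilterDim K A) ⊤ with hf | hf
  · simp [hf]
  rcases eq_or_ne (gkDimModule K A M) ⊤ with hg | hg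
  · simp [hg]
  refine ENNReal.div_le_of_le_mul ?_
  have hM : FiniteDimensional K (K ∙ x) := inferInstance
  have hx0 : (K ∙ x) ≠ ⊥ := by simpa using hx
  have h : ∀ i j : ℕ, leftReturnFunction V i ≤ j → _ := fun i j hij =>
    finrank_pow_le_mul hV.finiteDimensional hV.one_mem hM hx0 hij
  refine (growthDegree_le_of_le_mul
    (g := fun i => Module.finrank K (V ^ i : Submodule K A))
    (D := fun i => Module.finrank K (smulSpan (V ^ i) (K ∙ x))) h
    (ne_top_of_le_ne_top hg hD) (ne_top_of_le_ne_top hf hl)).trans ?_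
  exact mul_le_mul' hD (add_le_add hl (max_le_max hl le_rfl))

end GKModules

/-! ### Comparison of the two filter dimensions. -/

section

variable {K : Type*} [Field K] {A : Type*} [Ring A] [Algebra K A]

theorem leftReturnFunction_le_returnFunction (V : Submodule K A) (i : ℕ) :
    leftReturnFunction V i ≤ returnFunction V i := by
  refine le_iInf₂ fun j hj => iInf₂_le j fun a ha ha0 => ?_
  have hle : V ^ j * Submodule.span K {a} * V ^ j ≤
      (Ideal.span {x : A | ∃ y ∈ V ^ j, x = a * y}).restrictScalars K := by
    refine Submodule.mul_le.2 fun p hp y hy => ?_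
    have hp' : p ∈ Submodule.map (LinearMap.mulRight K a) ⊤ := by
      refine (Submodule.mul_le.2 fun b _ c hc => ?_ : V ^ j * Submodule.span K {a} ≤ _) hp
      obtain ⟨r, rfl⟩ := Submodule.mem_span_singleton.1 hc
      exact ⟨r • b, trivial, by simp⟩
    obtain ⟨b, -, rfl⟩ := hp'
    have := (Ideal.span {x : A | ∃ y ∈ V ^ j, x = a * y}).mul_mem_left b
      (Ideal.subset_span ⟨y, hy, rfl⟩)
    simpa [mul_assoc] using this
  exact hle (hj a ha ha0)

variable (K A) in
theorem leftFilterDim_le_filterDim : leftFilterDim K A ≤ filterDim K A :=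
  iSup₂_mono fun V _ => growthDegree_mono
    (Eventually.of_forall (leftReturnFunction_le_returnFunction V))

end

/-! ### Standard filtrations under extension of the base field. -/

section BaseChange

variable {K : Type*} [Field K] {A : Type*} [Ring A] [Algebra K A]

theorem IsStandardGenerating.exists_mem_pow {V : Submodule K A} (hV : IsStandardGenerating K A V)
    (a : A) : ∃ n, a ∈ V ^ n := by
  have h1 : 1 ≤ V := Submodule.one_le.2 hV.one_mem
  have ha : a ∈ Algebra.adjoin K (V : Set A) := hV.adjoin_eq_top ▸ Algebra.mem_top
  induction ha using Algebra.adjoin_induction with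
  | mem x hx => exact ⟨1, by simpa using hx⟩
  | algebraMap r => exact ⟨0, by simp [Submodule.mem_one]⟩
  | add x y _ _ hx hy =>
    obtain ⟨m, hm⟩ := hx
    obtain ⟨n, hn⟩ := hy
    exact ⟨max m n, add_mem (pow_le_pow_right' h1 (le_max_left m n) hm)
      (pow_le_pow_right' h1 (le_max_right m n) hn)⟩
  | mul x y _ _ hx hy =>
    obtain ⟨m, hm⟩ := hx
    obtain ⟨n, hn⟩ := hy
    exact ⟨m + n, by rw [pow_add]; exact Submodule.mul_mem_mul hm hn⟩

theorem IsStandardGenerating.exists_le_pow {V : Submodule K A} (hV : IsStandardGenerating K A V)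
    {W : Submodule K A} (hW : FiniteDimensional K W) : ∃ n, 0 < n ∧ W ≤ V ^ n := by
  have h1 : 1 ≤ V := Submodule.one_le.2 hV.one_mem
  obtain ⟨s, rfl⟩ := Module.Finite.iff_fg.1 hW
  choose n hn using hV.exists_mem_pow
  refine ⟨s.sup n + 1, Nat.succ_pos _, Submodule.span_le.2 fun x hx => ?_⟩
  exact pow_le_pow_right' h1 ((Finset.le_sup hx).trans (Nat.le_succ _)) (hn x)

theorem exists_isStandardGenerating (h : Algebra.FiniteType K A) :
    ∃ V : Submodule K A, IsStandardGenerating K A V := by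
  obtain ⟨s, hs⟩ := h.out
  refine ⟨Submodule.span K (insert 1 (s : Set A)), ?_, ?_, ?_⟩
  · exact FiniteDimensional.span_of_finite K ((Finset.finite_toSet s).insert 1)
  · exact Submodule.subset_span (Set.mem_insert _ _)
  · rw [eq_top_iff, ← hs]
    exact Algebra.adjoin_mono ((Set.subset_insert _ _).trans Submodule.subset_span)

variable (F : Type*) [Field F] [Algebra K F]

theorem baseChange_mul (V W : Submodule K A) :
    (V * W).baseChange F = V.baseChange F * W.baseChange F := by
  rw [← Submodule.span_eq V, ← Submodule.span_eq W, Submodule.span_mul_span]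
  simp only [Submodule.baseChange_span, Submodule.span_mul_span]
  congr 1
  ext x
  simp only [Set.mem_image, Set.mem_mul]
  constructor
  · rintro ⟨_, ⟨a, ha, b, hb, rfl⟩, rfl⟩
    exact ⟨_, ⟨a, ha, rfl⟩, _, ⟨b, hb, rfl⟩, by simp⟩
  · rintro ⟨_, ⟨a, ha, rfl⟩, _, ⟨b, hb, rfl⟩, rfl⟩
    exact ⟨_, ⟨a, ha, b, hb, rfl⟩, by simp⟩

theorem baseChange_pow (V : Submodule K A) (i : ℕ) :
    (V ^ i).baseChange F = V.baseChange F ^ i := by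
  induction i with
  | zero =>
    rw [pow_zero, pow_zero, Submodule.one_eq_span, Submodule.one_eq_span,
      Submodule.baseChange_span, Set.image_singleton]
    rfl
  | succ i ih => rw [pow_succ, pow_succ, baseChange_mul, ih]

theorem finrank_baseChange (V : Submodule K A) :
    Module.finrank F (V.baseChange F) = Module.finrank K V := by
  rw [← Module.finrank_baseChange (R := F) (S := K) (M' := V)]
  exact (LinearEquiv.ofBijective (V.toBaseChange F)
    ⟨V.toBaseChange_injective F, V.toBaseChange_surjective F⟩).finrank_eq.symm

theorem IsStandardGenerating.baseChange {V : Submodule K A} (hV : IsStandardGenerating K A V) :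
    IsStandardGenerating F (F ⊗[K] A) (V.baseChange F) where
  finiteDimensional := by
    have := hV.finiteDimensional
    exact Module.Finite.of_surjective (V.toBaseChange F) (V.toBaseChange_surjective F)
  one_mem := Submodule.tmul_mem_baseChange_of_mem 1 hV.one_mem
  adjoin_eq_top := by
    set T := Algebra.adjoin F ((V.baseChange F : Submodule F (F ⊗[K] A)) : Set (F ⊗[K] A))
    have hle : Algebra.adjoin K (V : Set A) ≤
        (T.restrictScalars K).comap Algebra.TensorProduct.includeRight :=
      Algebra.adjoin_le fun a ha =>
        Algebra.subset_adjoin (Submodule.tmul_mem_baseChange_of_mem 1 ha)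
    rw [hV.adjoin_eq_top] at hle
    refine eq_top_iff.2 fun z _ => ?_
    induction z with
    | zero => exact zero_mem _
    | add x y hx hy => exact add_mem (hx trivial) (hy trivial)
    | tmul q a =>
      have : (1 : F) ⊗ₜ[K] a ∈ T := hle (Algebra.mem_top (x := a))
      simpa [TensorProduct.smul_tmul'] using T.smul_mem this q

theorem finrank_baseChange_pow (V : Submodule K A) (i : ℕ) :
    Module.finrank F (V.baseChange F ^ i : Submodule F (F ⊗[K] A)) =
      Module.finrank K (V ^ i : Submodule K A) := by
  rw [← baseChange_pow, finrank_baseChange]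

/-- One filtration controls all others: `W ≤ V ^ c` and `M₀ ≤ V ^ d` give `W ^ i M₀ ≤ V ^ (c * i +
d)`. -/
theorem gkDimModule_self_le_growthDegree {V : Submodule K A} (hV : IsStandardGenerating K A V) :
    gkDimModule K A A ≤ growthDegree fun i => (Module.finrank K (V ^ i : Submodule K A) : ℕ∞) := by
  refine iSup₂_le fun W hW => iSup₂_le fun M₀ hM => ?_
  obtain ⟨c, hc, hWc⟩ := hV.exists_le_pow hW.finiteDimensional
  obtain ⟨d, -, hMd⟩ := hV.exists_le_pow hM
  refine (growthDegree_mono (Eventually.of_forall fun i => ?_)).trans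
    (growthDegree_comp_affine_le _ hc d)
  have hfin := finiteDimensional_pow hV.finiteDimensional (c * i + d)
  have hle : smulSpan (W ^ i) M₀ ≤ V ^ (c * i + d) := by
    refine smulSpan_le fun a ha x hx => ?_
    rw [pow_add, pow_mul]
    exact Submodule.mul_mem_mul (pow_le_pow_left' hWc i ha) (hMd hx)
  exact_mod_cast Submodule.finrank_mono hle

variable (K A) in
theorem gkDimModule_baseChange_self_le (h : Algebra.FiniteType K A) :
    gkDimModule F (F ⊗[K] A) (F ⊗[K] A) ≤ gkDimAlgebra K A := by
  obtain ⟨V, hV⟩ := exists_isStandardGenerating h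
  refine (gkDimModule_self_le_growthDegree (hV.baseChange F)).trans ?_
  simp only [finrank_baseChange_pow]
  exact le_iSup₂_of_le V hV le_rfl

variable (K A) in
-- The filter inequality over `F`; its numerator can be computed over `K` because base change
-- preserves the dimension of `V ^ i`.
theorem gkDimAlgebra_div_le_gkDimModule (M : Type*) [AddCommGroup M] [Module F M]
    [Module (F ⊗[K] A) M] [IsScalarTower F (F ⊗[K] A) M] [Nontrivial M] :
    gkDimAlgebra K A / (leftFilterDim F (F ⊗[K] A) + max (leftFilterDim F (F ⊗[K] A)) 1) ≤
      gkDimModule F (F ⊗[K] A) M := by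
  simp only [gkDimAlgebra, ENNReal.iSup_div]
  refine iSup₂_le fun V hV => ?_
  have := growthDegree_finrank_pow_div_le M (hV.baseChange F)
  simpa only [finrank_baseChange_pow] using this

end BaseChange

/-! ### Gaining one dimension from an injective endomorphism. -/

section Partitive

variable {F : Type u} [Field F] {R : Type v} [Ring R] [Algebra F R]
  {M : Type v} [AddCommGroup M] [Module F M] [Module R M] [IsScalarTower F R M]
  {M' : Type v} [AddCommGroup M'] [Module F M'] [Module R M'] [IsScalarTower F R M']

/-- Send `y` with `Θ ^ k y ∈ P` to the class of `Θ ^ k y`. If this class vanishes, injectivity of `Θ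
^ k` gives `y ∈ range Θ = ker π`, so `π y` depends only on the class. -/
theorem gkDimModule_le_subquotient {Θ : M →ₗ[R] M} (hΘ : Function.Injective Θ)
    {π : M →ₗ[R] M'} (hπ : LinearMap.ker π = LinearMap.range Θ) (P : Submodule R M) (k : ℕ)
    (P' : Submodule R M') (hP' : P' ≤ (P.comap (Θ ^ k)).map π) :
    gkDimModule F R P' ≤ gkDimModule F R
      (((LinearMap.range (Θ ^ k)).comap P.subtype : Submodule R P) ⧸
        ((LinearMap.range (Θ ^ (k + 1))).comap P.subtype).submoduleOf
          ((LinearMap.range (Θ ^ k)).comap P.subtype)) := by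
  have hinj : Function.Injective (Θ ^ k : Module.End R M) := by
    rw [Module.End.coe_pow]
    exact hΘ.iterate k
  let f₀ : P.comap (Θ ^ k) →ₗ[R] ((LinearMap.range (Θ ^ k)).comap P.subtype : Submodule R P) :=
    { toFun := fun y => ⟨⟨(Θ ^ k) y, y.2⟩, ⟨y, rfl⟩⟩
      map_add' := fun y z => Subtype.ext (Subtype.ext (by simp))
      map_smul' := fun a y => Subtype.ext (Subtype.ext (by simp)) }
  let f := (((LinearMap.range (Θ ^ (k + 1))).comap P.subtype).submoduleOf
    ((LinearMap.range (Θ ^ k)).comap P.subtype)).mkQ ∘ₗ f₀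
  let g : P.comap (Θ ^ k) →ₗ[R] M' := π.domRestrict _
  have hfg : LinearMap.ker f ≤ LinearMap.ker g := by
    intro y hy
    have hy' : f₀ y ∈ ((LinearMap.range (Θ ^ (k + 1))).comap P.subtype).submoduleOf
        ((LinearMap.range (Θ ^ k)).comap P.subtype) := by
      simpa [f] using hy
    obtain ⟨z, hz⟩ : ∃ z, (Θ ^ (k + 1)) z = (Θ ^ k) (y : M) := hy'
    rw [pow_succ, Module.End.mul_apply] at hz
    have hyz : (y : M) ∈ LinearMap.range Θ := ⟨z, hinj hz⟩
    rw [← hπ] at hyz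
    exact hyz
  have hrange : P' ≤ LinearMap.range g := by
    intro y hy
    obtain ⟨z, hz, rfl⟩ := hP' hy
    exact ⟨⟨z, hz⟩, rfl⟩
  exact (gkDimModule_le_of_injective (Submodule.inclusion hrange)
    (Submodule.inclusion_injective hrange)).trans (gkDimModule_range_le_of_ker_le f g hfg)

theorem IsFinitelyPartitive.add_one_le_gkDimModule (hpart : IsFinitelyPartitive F R)
    (hnat : HasNatGKDims F R) {Θ : M →ₗ[R] M} (hΘ : Function.Injective Θ)
    {π : M →ₗ[R] M'} (hπ : LinearMap.ker π = LinearMap.range Θ)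
    {P : Submodule R M} (hP : Module.Finite R P) {c : ℝ≥0∞}
    (h : ∀ k, ∃ P' : Submodule R M', Module.Finite R P' ∧ P' ≠ ⊥ ∧ c ≤ gkDimModule F R P' ∧
      P' ≤ (P.comap (Θ ^ k)).map π) :
    c + 1 ≤ gkDimModule F R P := by
  obtain ⟨p, -, hp⟩ := hpart P hP
  let N : ℕ → Submodule R P := fun k => (LinearMap.range (Θ ^ k)).comap P.subtype
  have hN0 : N 0 = ⊤ := by
    refine eq_top_iff.2 fun x _ => ?_
    exact ⟨x, by simp⟩
  have hNlt (k : ℕ) : N (k + 1) < N k := by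
    refine lt_of_le_of_ne ?_ ?_
    · rintro x ⟨z, hz⟩
      exact ⟨Θ z, by rw [← hz, pow_succ, Module.End.mul_apply]⟩
    · intro heq
      obtain ⟨P', -, hP'0, -, hP'⟩ := h k
      obtain ⟨w, hw, hw0⟩ := Submodule.exists_mem_ne_zero_of_ne_bot hP'0
      obtain ⟨y, hy, rfl⟩ := hP' hw
      have hmem : (⟨(Θ ^ k) y, hy⟩ : P) ∈ N (k + 1) := heq ▸ ⟨y, rfl⟩
      obtain ⟨z, hz⟩ : ∃ z, (Θ ^ (k + 1)) z = (Θ ^ k) y := hmem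
      rw [pow_succ, Module.End.mul_apply] at hz
      have hinj : Function.Injective (Θ ^ k : Module.End R M) := by
        rw [Module.End.coe_pow]
        exact hΘ.iterate k
      have : y ∈ LinearMap.ker π := hπ ▸ ⟨z, hinj hz⟩
      exact hw0 this
  -- A chain with `p + 1` steps exceeds the partitivity bound `p`, so some factor has a different
  -- dimension, necessarily a smaller one.
  obtain ⟨i, hi⟩ : ∃ i : Fin (p + 1), gkDimModule F R
      (N i.castSucc ⧸ (N i.succ).submoduleOf (N i.castSucc)) ≠ gkDimModule F R P := by
    by_contra! hall
    have := hp (p + 1) (fun i => N i) hN0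
      ((strictAnti_nat_of_succ_lt hNlt).comp_strictMono Fin.val_strictMono) hall
    omega
  have hlt : gkDimModule F R (N i.castSucc ⧸ (N i.succ).submoduleOf (N i.castSucc)) <
      gkDimModule F R P :=
    lt_of_le_of_ne ((gkDimModule_le_of_surjective _ (Submodule.mkQ_surjective _)).trans
      (gkDimModule_le_of_injective (Submodule.subtype _) Subtype.val_injective)) hi
  obtain ⟨P', hfin, -, hc, hP'⟩ := h i
  obtain ⟨a, ha⟩ := hnat P' hfin
  obtain ⟨b, hb⟩ := hnat P hP
  have hab : (a : ℝ≥0∞) < b := by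
    rw [← ha, ← hb]
    exact (gkDimModule_le_subquotient hΘ hπ P i P' hP').trans_lt hlt
  have hab' : a + 1 ≤ b := by exact_mod_cast hab
  calc c + 1 ≤ (a : ℝ≥0∞) + 1 := by rw [← ha]; gcongr
    _ ≤ b := by exact_mod_cast hab'
    _ = _ := hb.symm

end Partitive

/-! ### Modules with a left and a right multiplication action. -/

noncomputable section

/-- The algebra `T` as a module over `F ⊗[K] A`, where `a : A` acts by left multiplication with
`α a` and `q : F` by right multiplication with `β q`. -/
@[nolint unusedArguments]
def TwistedModule {K F A T : Type*} [Field K] [Field F] [Algebra K F] [Ring A] [Algebra K A]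
    [Ring T] [Algebra K T] (_ : A →ₐ[K] T) (_ : F →ₐ[K] T) : Type _ := T

namespace TwistedModule

variable {K F A T : Type*} [Field K] [Field F] [Algebra K F] [Ring A] [Algebra K A]
    [Ring T] [Algebra K T] (α : A →ₐ[K] T) (β : F →ₐ[K] T)

instance : AddCommGroup (TwistedModule α β) := inferInstanceAs (AddCommGroup T)

instance : Module K (TwistedModule α β) := inferInstanceAs (Module K T)

/-- The identity of `T`. -/
def of : T ≃ₗ[K] TwistedModule α β := LinearEquiv.refl K T

instance : Module A (TwistedModule α β) where
  smul a z := of α β (α a * (of α β).symm z)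
  one_smul z := by change α 1 * _ = _; rw [map_one, one_mul]; rfl
  mul_smul a b z := by change α (a * b) * _ = α a * (α b * _); rw [map_mul, mul_assoc]
  smul_zero a := mul_zero (α a)
  smul_add a := mul_add (α a)
  add_smul a b z := by
    change α (a + b) * _ = α a * _ + α b * _; rw [map_add, add_mul]
  zero_smul z := by change α 0 * _ = _; rw [map_zero, zero_mul]; rfl

/-- Right multiplication gives a left action because `F` is commutative. -/
instance : Module F (TwistedModule α β) where
  smul q z := of α β ((of α β).symm z * β q)
  one_smul z := by change _ * β 1 = _; rw [map_one, mul_one]; rfl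
  mul_smul a b z := by change _ * β (a * b) = _ * β b * β a; rw [mul_comm, map_mul, mul_assoc]
  smul_zero q := zero_mul (β q)
  smul_add q y z := add_mul _ _ (β q)
  add_smul a b z := by
    change _ * β (a + b) = _ * β a + _ * β b; rw [map_add, mul_add]
  zero_smul z := by change _ * β 0 = _; rw [map_zero, mul_zero]; rfl

instance : IsScalarTower K A (TwistedModule α β) where
  smul_assoc k a z := by
    change α (k • a) * (of α β).symm z = k • (α a * (of α β).symm z)
    rw [map_smul, smul_mul_assoc]

instance : IsScalarTower K F (TwistedModule α β) where
  smul_assoc k a z := by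
    change (of α β).symm z * β (k • a) = k • ((of α β).symm z * β a)
    rw [map_smul, mul_smul_comm]

instance : SMulCommClass F A (TwistedModule α β) where
  smul_comm q a z := mul_assoc (α a) ((of α β).symm z) (β q)

instance : Module (F ⊗[K] A) (TwistedModule α β) := TensorProduct.Algebra.module

theorem tmul_smul_of (q : F) (a : A) (z : T) :
    (q ⊗ₜ[K] a) • of α β z = of α β (α a * z * β q) := rfl

instance : IsScalarTower F (F ⊗[K] A) (TwistedModule α β) where
  smul_assoc q x z := by
    induction x with
    | zero => simp
    | add x y hx hy => simp only [smul_add, add_smul, hx, hy]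
    | tmul p a =>
      change (q • p) • a • z = q • p • a • z
      rw [smul_assoc]

variable {α β}

/-- A subgroup of `T` stable under both actions, as a submodule. -/
def submodule (I : AddSubgroup T) (hα : ∀ a, ∀ z ∈ I, α a * z ∈ I) (hβ : ∀ q, ∀ z ∈ I, z * β q ∈ I) :
    Submodule (F ⊗[K] A) (TwistedModule α β) where
  carrier := {z | (of α β).symm z ∈ I}
  add_mem' := I.add_mem
  zero_mem' := I.zero_mem
  smul_mem' x z hz := by
    induction x with
    | zero => simp [I.zero_mem]
    | add x y hx hy => rw [add_smul]; exact I.add_mem hx hy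
    | tmul q a => exact hβ q _ (hα a _ hz)

variable (α β) in
/-- Right multiplication by an element that commutes with the image of `β`. -/
def mulRight (θ : T) (h : ∀ q, Commute θ (β q)) :
    TwistedModule α β →ₗ[F ⊗[K] A] TwistedModule α β where
  toFun z := of α β ((of α β).symm z * θ)
  map_add' y z := add_mul _ _ θ
  map_smul' x z := by
    induction x with
    | zero => simp
    | add x y hx hy => simp only [add_smul, map_add, add_mul] at hx hy ⊢; rw [hx, hy]
    | tmul q a =>
      change α a * (of α β).symm z * β q * θ = α a * ((of α β).symm z * θ) * β q
      simp only [mul_assoc, (h q).eq]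

end TwistedModule

end

/-! ### Power series over the localization and Taylor expansion. -/

noncomputable section

namespace OreLocalization

variable {A : Type v} [Ring A] (S : Submonoid A) [OreSet S]

/-- Write `b s⁻¹` as a left fraction `s'⁻¹ a`. -/
theorem exists_mul_eq_mul (b : A[S⁻¹]) (s : S) :
    ∃ (s' : S) (a : A), (numeratorHom (s' : A) : A[S⁻¹]) * b =
      numeratorHom a * numeratorHom (s : A) := by
  obtain ⟨u, hu⟩ := numerator_isUnit (S := S) s
  have key : ∀ c : A[S⁻¹], ∃ (s' : S) (a : A), (numeratorHom (s' : A) : A[S⁻¹]) * c =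
      numeratorHom a := by
    intro c
    induction c using OreLocalization.ind with
    | _ r t =>
      refine ⟨t, r, ?_⟩
      rw [numeratorHom_apply, numeratorHom_apply, OreLocalization.mul_cancel]
  obtain ⟨s', a, h⟩ := key (b * ↑u⁻¹)
  refine ⟨s', a, ?_⟩
  rw [← hu, ← h, mul_assoc, mul_assoc, Units.inv_mul, mul_one]

end OreLocalization

section Taylor

variable {K : Type u} [Field K] {m : ℕ} {L : Type*} [Field L] [Algebra K L] {x : Fin m → L}

/-- A power series over a field is a unit when its constant term is nonzero, so by algebraic
independence `p(x + t)` is invertible for `p ≠ 0`. The `ULift` places the power series in the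
universe of `Q_m ⊗ A`, where the hypotheses on modules apply. -/
theorem constantCoeff_aeval_C_add_X (p : MvPolynomial (Fin m) K) :
    MvPowerSeries.constantCoeff (MvPolynomial.aeval (fun i => MvPowerSeries.C (x i) +
      (MvPowerSeries.X (ULift.up.{u} i) : MvPowerSeries (ULift.{u} (Fin m)) L)) p) =
      MvPolynomial.aeval x p := by
  induction p using MvPolynomial.induction_on with
  | C a => simp [MvPowerSeries.algebraMap_apply]
  | add p q hp hq => simp [hp, hq]
  | mul_X p i hp => simp [hp]

/-- The Taylor expansion `q(y) ↦ q(x + t)` of rational functions at an algebraically independent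
family `x`. -/
def taylorExpansion (hx : AlgebraicIndependent K x) :
    RatFuncField K m →ₐ[K] MvPowerSeries (ULift.{u} (Fin m)) L :=
  IsLocalization.liftAlgHom (M := nonZeroDivisors (MvPolynomial (Fin m) K))
    (f := MvPolynomial.aeval fun i => MvPowerSeries.C (x i) + MvPowerSeries.X (ULift.up.{u} i))
    fun p => by
      rw [MvPowerSeries.isUnit_iff_constantCoeff, constantCoeff_aeval_C_add_X, isUnit_iff_ne_zero]
      intro h
      exact nonZeroDivisors.ne_zero p.2 (hx.eq_zero_of_aeval_eq_zero _ h)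

theorem taylorExpansion_X (hx : AlgebraicIndependent K x) (i : Fin m) :
    taylorExpansion hx (algebraMap (MvPolynomial (Fin m) K) (RatFuncField K m) (MvPolynomial.X i)) =
      MvPowerSeries.C (x i) + MvPowerSeries.X (ULift.up.{u} i) := by
  simp [taylorExpansion, IsLocalization.liftAlgHom_apply]

variable {A : Type v} [Ring A] [Algebra K A] {S : Submonoid A} [OreSet S]

variable (K m S) in
/-- The algebra `A` in the constants of the power series over its localization. -/
def constHom : A →ₐ[K] MvPowerSeries (ULift.{u} (Fin m)) A[S⁻¹] where
  __ := MvPowerSeries.C.comp (numeratorRingHom : A →+* A[S⁻¹])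
  commutes' r := by rw [MvPowerSeries.algebraMap_apply]; rfl

theorem constHom_apply (a : A) : constHom K m S a = MvPowerSeries.C (numeratorHom a) := rfl

/-- The Taylor expansion with coefficients in the localization. -/
def taylorHom (hx : AlgebraicIndependent K x) (ι : L →ₐ[K] A[S⁻¹]) :
    RatFuncField K m →ₐ[K] MvPowerSeries (ULift.{u} (Fin m)) A[S⁻¹] :=
  (MvPowerSeries.mapAlgHom ι).comp (taylorExpansion hx)

theorem taylorHom_X (hx : AlgebraicIndependent K x) (ι : L →ₐ[K] A[S⁻¹]) (i : Fin m) :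
    taylorHom hx ι (algebraMap (MvPolynomial (Fin m) K) (RatFuncField K m) (MvPolynomial.X i)) =
      MvPowerSeries.C (ι (x i)) + MvPowerSeries.X (ULift.up.{u} i) := by
  rw [taylorHom, AlgHom.comp_apply, taylorExpansion_X, map_add]
  exact congrArg₂ (· + ·) (MvPowerSeries.map_C (ι : L →+* A[S⁻¹]) _)
    (MvPowerSeries.map_X (ι : L →+* A[S⁻¹]) _)

/-- The power series over `S⁻¹ A` as a module over `K(y) ⊗ A`. -/
abbrev TaylorModule (hx : AlgebraicIndependent K x) (ι : L →ₐ[K] A[S⁻¹]) : Type _ :=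
  TwistedModule (constHom K m S) (taylorHom hx ι)

namespace TaylorModule

variable (hx : AlgebraicIndependent K x) (ι : L →ₐ[K] A[S⁻¹])

/-- A power series as an element of the Taylor module. -/
abbrev of : MvPowerSeries (ULift.{u} (Fin m)) A[S⁻¹] ≃ₗ[K] TaylorModule hx ι :=
  TwistedModule.of (constHom K m S) (taylorHom hx ι)

/-- The submodule generated by the constant `s`. -/
def cyclic (s : S) : Submodule (RatFuncField K m ⊗[K] A) (TaylorModule hx ι) :=
  Submodule.span _ {of hx ι (MvPowerSeries.C (numeratorHom (s : A)))}

/-- The indeterminate `y_i` of `Q_m` acts as `x_i + t_i`, so `b t_i ^ (k + 1)` is the difference of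
`(b t_i ^ k) • y_i` and `(b x_i) t_i ^ k`. Induction on `k` therefore needs all coefficients `b` at
once; `k = 0` is clearing of denominators. -/
theorem exists_of_mem_cyclic (s : S) (z : MvPowerSeries (ULift.{u} (Fin m)) A[S⁻¹])
    (hz : ∃ (b : A[S⁻¹]) (i : Fin m) (k : ℕ),
      z = MvPowerSeries.C b * MvPowerSeries.X (ULift.up.{u} i) ^ k) :
    ∃ s' : S, of hx ι (MvPowerSeries.C (numeratorHom (s' : A)) * z) ∈ cyclic hx ι s := by
  have hleft (a : A) {w} (hw : of hx ι w ∈ cyclic hx ι s) :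
      of hx ι (MvPowerSeries.C (numeratorHom a) * w) ∈ cyclic hx ι s := by
    have := (cyclic hx ι s).smul_mem ((1 : RatFuncField K m) ⊗ₜ[K] a) hw
    rwa [TwistedModule.tmul_smul_of, map_one, mul_one] at this
  have hright (q : RatFuncField K m) {w} (hw : of hx ι w ∈ cyclic hx ι s) :
      of hx ι (w * taylorHom hx ι q) ∈ cyclic hx ι s := by
    have := (cyclic hx ι s).smul_mem (q ⊗ₜ[K] (1 : A)) hw
    rwa [TwistedModule.tmul_smul_of, map_one, one_mul] at this
  have hsub {w z} (hw : ∃ s' : S, of hx ι (MvPowerSeries.C (numeratorHom (s' : A)) * w) ∈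
      cyclic hx ι s) (hz : ∃ s' : S, of hx ι (MvPowerSeries.C (numeratorHom (s' : A)) * z) ∈
      cyclic hx ι s) : ∃ s' : S, of hx ι (MvPowerSeries.C (numeratorHom (s' : A)) * (w - z)) ∈
      cyclic hx ι s := by
    obtain ⟨s₁, h₁⟩ := hw
    obtain ⟨s₂, h₂⟩ := hz
    -- The common left multiple `t * s₁ = r * s₂` serves as a denominator for both terms.
    obtain ⟨r, t, h⟩ := oreCondition (s₁ : A) s₂
    refine ⟨t * s₁, ?_⟩
    rw [mul_sub, map_sub]
    refine sub_mem ?_ ?_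
    · have := hleft t h₁
      rwa [← mul_assoc, ← map_mul, ← map_mul] at this
    · have := hleft r h₂
      rwa [← mul_assoc, ← map_mul, ← map_mul, ← h] at this
  obtain ⟨b, i, k, rfl⟩ := hz
  induction k generalizing b with
  | zero =>
    obtain ⟨s', a, h⟩ := exists_mul_eq_mul S b s
    refine ⟨s', ?_⟩
    rw [pow_zero, mul_one, ← map_mul, h, map_mul]
    exact hleft a (Submodule.subset_span rfl)
  | succ k ih =>
    have h : MvPowerSeries.C b * MvPowerSeries.X (ULift.up.{u} i) ^ (k + 1) =
        MvPowerSeries.C b * MvPowerSeries.X (ULift.up.{u} i) ^ k * taylorHom hx ι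
          (algebraMap (MvPolynomial (Fin m) K) (RatFuncField K m) (MvPolynomial.X i)) -
        MvPowerSeries.C (b * ι (x i)) * MvPowerSeries.X (ULift.up.{u} i) ^ k := by
      rw [taylorHom_X, mul_add, map_mul, mul_assoc _ _ (MvPowerSeries.C (ι (x i))),
        mul_assoc _ (MvPowerSeries.C (ι (x i))) _, MvPowerSeries.X_pow_mul, add_sub_cancel_left,
        mul_assoc, ← pow_succ]
    rw [h]
    refine hsub ?_ (ih _)
    obtain ⟨s', hs'⟩ := ih b
    exact ⟨s', by rw [← mul_assoc]; exact hright _ hs'⟩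

/-- The power series in the ideal generated by the first `j` variables. -/
def varIdeal (j : ℕ) : Submodule (RatFuncField K m ⊗[K] A) (TaylorModule hx ι) :=
  TwistedModule.submodule
    { carrier := {z | ∀ d : ULift.{u} (Fin m) →₀ ℕ, (∀ i : Fin m, (i : ℕ) < j → d ⟨i⟩ = 0) →
        MvPowerSeries.coeff d z = 0}
      add_mem' := fun hy hz d hd => by rw [map_add, hy d hd, hz d hd, add_zero]
      zero_mem' := fun d _ => map_zero _
      neg_mem' := fun hy d hd => by rw [map_neg, hy d hd, neg_zero] }
    (fun a z hz d hd => by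
      rw [constHom_apply, MvPowerSeries.coeff_C_mul, hz d hd, mul_zero])
    (fun q z hz d hd => by
      classical
      rw [MvPowerSeries.coeff_mul]
      refine Finset.sum_eq_zero fun p hp => ?_
      rw [hz p.1 fun i hi => ?_, zero_mul]
      have := DFunLike.congr_fun (Finset.HasAntidiagonal.mem_antidiagonal.1 hp) (ULift.up i)
      rw [hd i hi, Finsupp.add_apply] at this
      omega)

/-- At `j = 0` the condition on `d` is vacuous and the submodule is zero; at `j = m` only the
constant term must vanish. -/
theorem of_mem_varIdeal {j : ℕ} {z : MvPowerSeries (ULift.{u} (Fin m)) A[S⁻¹]} :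
    of hx ι z ∈ varIdeal hx ι j ↔ ∀ d : ULift.{u} (Fin m) →₀ ℕ,
      (∀ i : Fin m, (i : ℕ) < j → d ⟨i⟩ = 0) → MvPowerSeries.coeff d z = 0 := Iff.rfl

theorem varIdeal_le_succ (j : ℕ) : varIdeal hx ι j ≤ varIdeal hx ι (j + 1) :=
  fun _ hz d hd => hz d fun i hi => hd i (by omega)

/-- Multiplication by a variable. -/
def mulX (i : Fin m) : TaylorModule hx ι →ₗ[RatFuncField K m ⊗[K] A] TaylorModule hx ι :=
  TwistedModule.mulRight _ _ (MvPowerSeries.X ⟨i⟩) fun _ => (MvPowerSeries.commute_X _ _).symm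

theorem mulX_of (i : Fin m) (z : MvPowerSeries (ULift.{u} (Fin m)) A[S⁻¹]) :
    mulX hx ι i (of hx ι z) = of hx ι (z * MvPowerSeries.X ⟨i⟩) := rfl

/-- Raising the exponent of variable `j` leaves those of the variables before `j` unchanged. This
makes `quotMulX` well defined and injective. -/
theorem mulX_mem_varIdeal_iff (j : Fin m) (z : TaylorModule hx ι) :
    mulX hx ι j z ∈ varIdeal hx ι j ↔ z ∈ varIdeal hx ι j := by
  obtain ⟨z, rfl⟩ := (of hx ι).surjective z
  rw [mulX_of]
  constructor
  · intro h d hd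
    have := h (d + Finsupp.single ⟨j⟩ 1) fun i hi => by
      rw [Finsupp.add_apply, hd i hi, Finsupp.single_apply, if_neg (by
        rw [ULift.up_inj]
        omega), add_zero]
    change MvPowerSeries.coeff _ (z * _) = 0 at this
    rwa [MvPowerSeries.X, MvPowerSeries.coeff_add_mul_monomial, mul_one] at this
  · intro h d hd
    change MvPowerSeries.coeff _ (z * _) = 0
    classical
    rw [MvPowerSeries.coeff_mul]
    refine Finset.sum_eq_zero fun p hp => ?_
    have : MvPowerSeries.coeff p.1 z = 0 := h p.1 fun i hi => by
      have := DFunLike.congr_fun (Finset.HasAntidiagonal.mem_antidiagonal.1 hp) (ULift.up i)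
      rw [hd i hi, Finsupp.add_apply] at this
      omega
    rw [this, zero_mul]

theorem mulX_mem_varIdeal_succ (j : Fin m) (z : TaylorModule hx ι) :
    mulX hx ι j z ∈ varIdeal hx ι (j + 1) := by
  obtain ⟨z, rfl⟩ := (of hx ι).surjective z
  rw [mulX_of]
  intro d hd
  exact MvPowerSeries.X_dvd_iff.1 ⟨z, MvPowerSeries.X_mul.symm⟩ d (hd j (Nat.lt_succ_self _))

theorem exists_sub_mulX_mem_varIdeal (j : Fin m) {z : TaylorModule hx ι}
    (hz : z ∈ varIdeal hx ι (j + 1)) : ∃ w, z - mulX hx ι j w ∈ varIdeal hx ι j := by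
  classical
  obtain ⟨z, rfl⟩ := (of hx ι).surjective z
  -- The terms of `z` free of the variables before `j`. They are all divisible by variable `j`,
  -- since `z` has no term free of the variables up to `j`.
  let z' : MvPowerSeries (ULift.{u} (Fin m)) A[S⁻¹] := fun d =>
    if ∀ i : Fin m, (i : ℕ) < j → d ⟨i⟩ = 0 then MvPowerSeries.coeff d z else 0
  have hz' (d) : MvPowerSeries.coeff d z' =
      if ∀ i : Fin m, (i : ℕ) < j → d ⟨i⟩ = 0 then MvPowerSeries.coeff d z else 0 := rfl
  obtain ⟨w, hw⟩ : (MvPowerSeries.X ⟨j⟩) ∣ z' := by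
    refine MvPowerSeries.X_dvd_iff.2 fun d hd => ?_
    rw [hz']
    split_ifs with h
    · refine hz d fun i hi => ?_
      rcases Nat.lt_succ_iff_lt_or_eq.1 hi with hi | hi
      · exact h i hi
      · rw [Fin.ext hi, hd]
    · rfl
  refine ⟨of hx ι w, ?_⟩
  rw [mulX_of, ← MvPowerSeries.X_mul, ← hw, ← map_sub]
  intro d hd
  change MvPowerSeries.coeff d (z - z') = 0
  rw [map_sub, hz', if_pos hd, sub_self]

end TaylorModule

end Taylor

end

/-! ### Successive quotients by the variables and the lower bound. -/

noncomputable section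

namespace TaylorModule

variable {K : Type u} [Field K] {m : ℕ} {L : Type*} [Field L] [Algebra K L] {x : Fin m → L}
  {A : Type v} [Ring A] [Algebra K A] {S : Submonoid A} [OreSet S]
  (hx : AlgebraicIndependent K x) (ι : L →ₐ[K] A[S⁻¹])

/-- The quotient of the Taylor module by the first `j` variables. -/
abbrev Quot (j : ℕ) : Type _ := TaylorModule hx ι ⧸ varIdeal hx ι j

/-- Multiplication by a variable on the quotient by the previous ones. -/
def quotMulX (j : Fin m) : Quot hx ι j →ₗ[RatFuncField K m ⊗[K] A] Quot hx ι j :=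
  (varIdeal hx ι j).mapQ (varIdeal hx ι j) (mulX hx ι j)
    fun z hz => (mulX_mem_varIdeal_iff hx ι j z).2 hz

theorem quotMulX_mkQ (j : Fin m) (z : TaylorModule hx ι) :
    quotMulX hx ι j ((varIdeal hx ι j).mkQ z) = (varIdeal hx ι j).mkQ (mulX hx ι j z) := rfl

theorem quotMulX_injective (j : Fin m) : Function.Injective (quotMulX hx ι j) := by
  refine (injective_iff_map_eq_zero _).2 fun y hy => ?_
  obtain ⟨z, rfl⟩ := Submodule.mkQ_surjective _ y
  rw [quotMulX_mkQ] at hy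
  simp only [Submodule.mkQ_apply, Submodule.Quotient.mk_eq_zero] at hy ⊢
  exact (mulX_mem_varIdeal_iff hx ι j z).1 hy

theorem quotMulX_pow_mkQ_of (j : Fin m) (k : ℕ)
    (z : MvPowerSeries (ULift.{u} (Fin m)) A[S⁻¹]) :
    (quotMulX hx ι j ^ k) ((varIdeal hx ι j).mkQ (of hx ι z)) =
      (varIdeal hx ι j).mkQ (of hx ι (z * MvPowerSeries.X ⟨j⟩ ^ k)) := by
  induction k with
  | zero => simp
  | succ k ih =>
    rw [pow_succ', Module.End.mul_apply, ih, quotMulX_mkQ, mulX_of, mul_assoc, pow_succ]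

/-- The projection setting one more variable to zero. -/
def quotProj (j : ℕ) : Quot hx ι j →ₗ[RatFuncField K m ⊗[K] A] Quot hx ι (j + 1) :=
  Submodule.factor (varIdeal_le_succ hx ι j)

theorem quotProj_mkQ (j : ℕ) (z : TaylorModule hx ι) :
    quotProj hx ι j ((varIdeal hx ι j).mkQ z) = (varIdeal hx ι (j + 1)).mkQ z := rfl

theorem ker_quotProj (j : Fin m) :
    LinearMap.ker (quotProj hx ι j) = LinearMap.range (quotMulX hx ι j) := by
  apply le_antisymm
  · intro y hy
    obtain ⟨z, rfl⟩ := Submodule.mkQ_surjective _ y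
    rw [LinearMap.mem_ker, quotProj_mkQ, Submodule.mkQ_apply, Submodule.Quotient.mk_eq_zero] at hy
    obtain ⟨w, hw⟩ := exists_sub_mulX_mem_varIdeal hx ι j hy
    refine ⟨(varIdeal hx ι j).mkQ w, ?_⟩
    rw [quotMulX_mkQ]
    exact ((Submodule.Quotient.eq _).2 hw).symm
  · rintro _ ⟨y, rfl⟩
    obtain ⟨z, rfl⟩ := Submodule.mkQ_surjective _ y
    rw [quotMulX_mkQ, LinearMap.mem_ker, quotProj_mkQ, Submodule.mkQ_apply,
      Submodule.Quotient.mk_eq_zero]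
    exact mulX_mem_varIdeal_succ hx ι j z

/-- The submodule of the quotient generated by the constant `s`. -/
def quotCyclic (j : ℕ) (s : S) : Submodule (RatFuncField K m ⊗[K] A) (Quot hx ι j) :=
  Submodule.span _ {(varIdeal hx ι j).mkQ (of hx ι (MvPowerSeries.C (numeratorHom (s : A))))}

theorem map_mkQ_cyclic (j : ℕ) (s : S) :
    (cyclic hx ι s).map (varIdeal hx ι j).mkQ = quotCyclic hx ι j s := by
  rw [cyclic, quotCyclic, Submodule.map_span, Set.image_singleton]

theorem finite_quotCyclic (j : ℕ) (s : S) :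
    Module.Finite (RatFuncField K m ⊗[K] A) (quotCyclic hx ι j s) :=
  Module.Finite.iff_fg.2 (Submodule.fg_span_singleton _)

theorem quotCyclic_ne_bot [Nontrivial A[S⁻¹]] (j : ℕ) (s : S) : quotCyclic hx ι j s ≠ ⊥ := by
  rw [quotCyclic, Ne, Submodule.span_singleton_eq_bot, Submodule.mkQ_apply,
    Submodule.Quotient.mk_eq_zero]
  intro h
  have h0 := (of_mem_varIdeal hx ι).1 h 0 fun _ _ => rfl
  rw [MvPowerSeries.coeff_zero_C] at h0
  exact (numerator_isUnit s).ne_zero h0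

/-- Some `s' t_j ^ k` lies in the cyclic module of `s`, so the constant `s'` lies in its preimage
under multiplication by `t_j ^ k`. -/
theorem exists_quotCyclic_le (j : Fin m) (s : S) (k : ℕ) :
    ∃ s' : S, quotCyclic hx ι (j + 1) s' ≤
      ((quotCyclic hx ι j s).comap (quotMulX hx ι j ^ k)).map (quotProj hx ι j) := by
  obtain ⟨s', hs'⟩ := exists_of_mem_cyclic hx ι s
    (MvPowerSeries.X (ULift.up.{u} j) ^ k) ⟨1, j, k, by rw [map_one, one_mul]⟩
  refine ⟨s', ?_⟩
  rw [quotCyclic, Submodule.span_le, Set.singleton_subset_iff]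
  refine ⟨(varIdeal hx ι j).mkQ (of hx ι (MvPowerSeries.C (numeratorHom (s' : A)))), ?_, rfl⟩
  change (quotMulX hx ι j ^ k) _ ∈ quotCyclic hx ι j s
  rw [quotMulX_pow_mkQ_of, ← map_mkQ_cyclic]
  exact Submodule.mem_map_of_mem hs'

/-- A lower bound for the Gelfand-Kirillov dimension of the submodules generated by constants. -/
theorem add_le_gkDimModule_quotCyclic [Nontrivial A[S⁻¹]]
    (hpart : IsFinitelyPartitive (RatFuncField K m) (RatFuncField K m ⊗[K] A))
    (hnat : HasNatGKDims (RatFuncField K m) (RatFuncField K m ⊗[K] A)) (k j : ℕ) (hjk : j + k = m)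
    (s : S) :
    gkDimAlgebra K A / (leftFilterDim (RatFuncField K m) (RatFuncField K m ⊗[K] A) +
        max (leftFilterDim (RatFuncField K m) (RatFuncField K m ⊗[K] A)) 1) + k ≤
      gkDimModule (RatFuncField K m) (RatFuncField K m ⊗[K] A) (quotCyclic hx ι j s) := by
  -- The element `s` stays arbitrary: each factor of the chain brings its own `s'`.
  induction k generalizing j s with
  | zero =>
    have : Nontrivial (quotCyclic hx ι j s) :=
      Submodule.nontrivial_iff_ne_bot.2 (quotCyclic_ne_bot hx ι j s)
    rw [Nat.cast_zero, add_zero]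
    exact gkDimAlgebra_div_le_gkDimModule K A _ _
  | succ k ih =>
    obtain ⟨j, rfl⟩ : ∃ i : Fin m, (i : ℕ) = j := ⟨⟨j, by omega⟩, rfl⟩
    rw [Nat.cast_succ, ← add_assoc]
    refine hpart.add_one_le_gkDimModule hnat (quotMulX_injective hx ι j) (ker_quotProj hx ι j)
      (finite_quotCyclic hx ι j s) fun i => ?_
    obtain ⟨s', hs'⟩ := exists_quotCyclic_le hx ι j s i
    exact ⟨_, finite_quotCyclic hx ι _ s', quotCyclic_ne_bot hx ι _ s',
      ih (j + 1) (by omega) s', hs'⟩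

end TaylorModule

/-! ### The bound for the transcendence degree. -/

section Main

variable {K : Type u} [Field K] {A : Type v} [Ring A] [Algebra K A]

theorem card_le_of_algebraicIndependent (hfg : Algebra.FiniteType K A)
    (hfin : gkDimAlgebra K A < ∞)
    {S : Submonoid A} [OreSet S] {m : ℕ} {L : Type*} [Field L] [Algebra K L] {x : Fin m → L}
    (hx : AlgebraicIndependent K x) (ι : L →ₐ[K] A[S⁻¹]) [Nontrivial A[S⁻¹]]
    (hpart : IsFinitelyPartitive (RatFuncField K m) (RatFuncField K m ⊗[K] A))
    (hnat : HasNatGKDims (RatFuncField K m) (RatFuncField K m ⊗[K] A)) :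
    (m : ℝ≥0∞) ≤
      gkDimAlgebra K A * (1 - 1 / (maxLeftFilterDim K A + max (maxLeftFilterDim K A) 1)) := by
  have h₁ := TaylorModule.add_le_gkDimModule_quotCyclic hx ι hpart hnat m 0 (zero_add m) 1
  have h₂ : gkDimModule (RatFuncField K m) (RatFuncField K m ⊗[K] A)
      (TaylorModule.quotCyclic hx ι 0 1) ≤ gkDimAlgebra K A := by
    rw [TaylorModule.quotCyclic, ← LinearMap.range_toSpanSingleton]
    exact (gkDimModule_le_of_surjective _ (LinearMap.surjective_rangeRestrict _)).trans
      (gkDimModule_baseChange_self_le K A (RatFuncField K m) hfg)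
  have h₃ := h₁.trans h₂
  -- This places `m` in the range of the maximum that defines `f_A`.
  have hm : (m : ℝ≥0∞) ≤ gkDimAlgebra K A := le_add_self.trans h₃
  have hf : leftFilterDim (RatFuncField K m) (RatFuncField K m ⊗[K] A) ≤ maxLeftFilterDim K A :=
    le_iSup₂_of_le m hm le_rfl
  rw [ENNReal.mul_sub fun _ _ => hfin.ne, mul_one, mul_one_div]
  have hle : gkDimAlgebra K A / (maxLeftFilterDim K A + max (maxLeftFilterDim K A) 1) ≤
      gkDimAlgebra K A / (leftFilterDim (RatFuncField K m) (RatFuncField K m ⊗[K] A) +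
        max (leftFilterDim (RatFuncField K m) (RatFuncField K m ⊗[K] A)) 1) :=
    ENNReal.div_le_div_left (add_le_add hf (max_le_max hf le_rfl)) _
  exact ENNReal.le_sub_of_add_le_left (ne_top_of_le_ne_top hfin.ne (le_self_add.trans
    ((add_le_add hle le_rfl).trans h₃))) ((add_le_add hle le_rfl).trans h₃)

theorem exists_algebraicIndependent_fin {L : Type*} [Field L] [Algebra K L] {m : ℕ}
    (h : (m : ℕ∞) ≤ Cardinal.toENat (Algebra.trdeg K L)) :
    ∃ x : Fin m → L, AlgebraicIndependent K x := by
  obtain ⟨s, hs⟩ := exists_isTranscendenceBasis K L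
  have hcard : (m : Cardinal) ≤ Cardinal.mk s := by
    rwa [hs.cardinalMk_eq_trdeg, ← Cardinal.natCast_le_toENat]
  obtain ⟨e⟩ := Cardinal.lift_mk_le'.1
    (show Cardinal.lift (Cardinal.mk (Fin m)) ≤ Cardinal.lift (Cardinal.mk s) by simpa using hcard)
  exact ⟨_, hs.1.comp e e.injective⟩

variable (K A) in
theorem maxLeftFilterDim_le_maxFilterDim : maxLeftFilterDim K A ≤ maxFilterDim K A :=
  iSup₂_mono fun _ _ => leftFilterDim_le_filterDim _ _

/-- Bounding all finite independent families also covers infinite transcendence degree, where every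
`m` occurs. -/
theorem subfieldTrdeg_le {B : Type v} [Ring B] [Algebra K B] (L : Subalgebra K B) (hL : IsField L)
    {c : ℝ≥0∞} (h : ∀ (L' : Type v) [Field L'] [Algebra K L'] (_ : L' →ₐ[K] B) (m : ℕ)
      (x : Fin m → L'), AlgebraicIndependent K x → (m : ℝ≥0∞) ≤ c) :
    ((subfieldTrdeg L hL : ℕ∞) : ℝ≥0∞) ≤ c := by
  let _ : Field L := hL.toField
  let _ : Algebra K L := L.algebra
  have key (m : ℕ) (hm : (m : ℕ∞) ≤ subfieldTrdeg L hL) : (m : ℝ≥0∞) ≤ c := by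
    obtain ⟨x, hx⟩ := exists_algebraicIndependent_fin (K := K) (L := L) hm
    exact h L { L.val with } m x hx
  induction ht : subfieldTrdeg L hL using ENat.recTopCoe with
  | top =>
    rw [ht] at key
    refine ENNReal.le_of_forall_nnreal_lt fun r _ => ?_
    obtain ⟨m, hm⟩ := exists_nat_ge r
    exact le_trans (by exact_mod_cast hm) (key m le_top)
  | coe m => simpa using key m ht.ge

end Main

end

theorem mainTheorem8 (K : Type u) [Field K] (A : Type v) [Ring A] [Algebra K A]
    (hsimple : IsSimpleRing A) (hfg : Algebra.FiniteType K A)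
    (hpos : 0 < gkDimAlgebra K A) (hfin : gkDimAlgebra K A < ∞)
    (hQsimple : ∀ m : ℕ, IsSimpleRing (RatFuncField K m ⊗[K] A))
    (hQpartitive : ∀ m : ℕ, IsFinitelyPartitive (RatFuncField K m) (RatFuncField K m ⊗[K] A))
    (hQint : ∀ m : ℕ, HasNatGKDims (RatFuncField K m) (RatFuncField K m ⊗[K] A))
    (S : Submonoid A) [OreLocalization.OreSet S]
    (L : Subalgebra K (OreLocalization S A)) (hL : IsField L) :
    ((subfieldTrdeg L hL : ℕ∞) : ℝ≥0∞) ≤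
        gkDimAlgebra K A * (1 - 1 / (maxFilterDim K A + max (maxFilterDim K A) 1)) ∧
      ((subfieldTrdeg L hL : ℕ∞) : ℝ≥0∞) ≤
        gkDimAlgebra K A *
          (1 - 1 / (maxLeftFilterDim K A + max (maxLeftFilterDim K A) 1)) := by
  -- The localization is zero if `0 ∈ S`; the field `L` inside it excludes this.
  have hB : Nontrivial (OreLocalization S A) := by
    obtain ⟨a, b, hab⟩ := hL.exists_pair_ne
    exact ⟨a, b, fun h => hab (Subtype.ext h)⟩
  have key : ((subfieldTrdeg L hL : ℕ∞) : ℝ≥0∞) ≤ gkDimAlgebra K A *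
      (1 - 1 / (maxLeftFilterDim K A + max (maxLeftFilterDim K A) 1)) :=
    subfieldTrdeg_le L hL fun L' _ _ ι m x hx =>
      card_le_of_algebraicIndependent hfg hfin hx ι (hQpartitive m) (hQint m)
  refine ⟨key.trans ?_, key⟩
  have h := maxLeftFilterDim_le_maxFilterDim K A
  gcongr
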